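/- Let $M>0$, let $D=[0,1]\times[-M,M]\subset\mathbb{R}^2$, and let $G\colon D\to\mathbb{R}$ be a continuous function such that $G^{-1}(0)\cap\partial D$ is a finite set contained in $\{1\}\times(-M,M)$, where $\partial D$ is the boundary of the rectangle $D$ in $\mathbb{R}^2$. Suppose that some connected component $F$ of $G^{-1}(0)$ meets $\{1\}\times(-M,M)$ in exactly one point $(1,y_0)$, that is, $F\cap(\{1\}\times(-M,M))=\{(1,y_0)\}$. Then for every $\varepsilon>0$ there are $y_-,y_+\in(-M,M)$ with $y_0-\varepsilon<y_-<y_0<y_+<y_0+\varepsilon$ and a path (a continuous map $\gamma\colon[0,1]\to D\setminus G^{-1}(0)$) with $\gamma(0)=(1,y_-)$ and $\gamma(1)=(1,y_+)$. -/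

import Mathlib

open Set

/-- The closed rectangle `[0,1] × [-M,M]` in the plane. -/
def rectangle (M : ℝ) : Set (ℝ × ℝ) := Icc 0 1 ×ˢ Icc (-M) M

/-- The open right edge `{1} × (-M,M)` of the rectangle. -/
def rightEdge (M : ℝ) : Set (ℝ × ℝ) := {1} ×ˢ Ioo (-M) M

/-- The zero set `{p ∈ D | G p = 0}` of `G` on the rectangle `D = [0,1] × [-M,M]`;
the values of `G` outside `D` play no role. -/
def zeroSet (M : ℝ) (G : ℝ × ℝ → ℝ) : Set (ℝ × ℝ) := {p | p ∈ rectangle M ∧ G p = 0}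

/-- `F` is a connected component of the set `Z`. -/
def IsComponentOf (F Z : Set (ℝ × ℝ)) : Prop := ∃ p ∈ Z, F = connectedComponentIn Z p

/-! This is a Janiszewski-type argument. Since `F` contains no boundary zero except `(1, y₀)`, the
compact zero set splits into disjoint closed sets: `A` containing `(1, y₀)`, and `B` containing all
other boundary zeros. Take a short segment of the right edge around `y₀` with no other zero. It
misses `B`, and the rest of the boundary misses `A`; both join the segment's endpoints. If `A ∪ B`
separated these, a circle-valued map would have a lift taking two different values at one endpoint.
-/

/-- If `p` and `q` are separated neither by the closed set `A` nor by the closed set `B`, where `A`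
and `B` are disjoint and the ambient space is simply connected, then `A ∪ B` does not separate them
either. -/
theorem joinedIn_compl_union_of_disjoint {X : Type*} [TopologicalSpace X] [NormalSpace X]
    [SimplyConnectedSpace X] [LocallyPathConnectedSpace X] {A B S T : Set X} {p q : X}
    (hA : IsClosed A) (hB : IsClosed B) (hAB : Disjoint A B)
    (hS : IsPreconnected S) (hSA : Disjoint S A) (hpS : p ∈ S) (hqS : q ∈ S)
    (hT : IsPreconnected T) (hTB : Disjoint T B) (hpT : p ∈ T) (hqT : q ∈ T) :
    JoinedIn (A ∪ B)ᶜ p q := by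
  classical
  by_contra hpq
  obtain ⟨u, huA, huB, -⟩ := exists_continuous_zero_one_of_isClosed hA hB hAB
  have hO : IsOpen (A ∪ B)ᶜ := (hA.union hB).isOpen_compl
  have hp : p ∈ (A ∪ B)ᶜ := fun h ↦
    h.elim (fun h ↦ hSA.le_bot ⟨hpS, h⟩) fun h ↦ hTB.le_bot ⟨hpT, h⟩
  set W := pathComponentIn (A ∪ B)ᶜ p with hW
  have hpW : p ∈ W := mem_pathComponentIn_self hp
  have hqW : q ∉ W := hpq
  have hWo : IsOpen W := hO.pathComponentIn p
  have hfr : frontier W ⊆ A ∪ B := by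
    intro x hx
    by_contra hxO
    obtain ⟨y, hy, hyW⟩ := mem_closure_iff.1 hx.1 _ (hO.pathComponentIn x)
      (mem_pathComponentIn_self hxO)
    refine hx.2 (hWo.interior_eq.symm ▸ ?_)
    exact JoinedIn.trans hyW (JoinedIn.symm hy)
  -- The pieces agree on the frontier of `W`, where `u` is `0` or `1`, hence zero in the circle.
  have hc : Continuous (W.piecewise (fun x ↦ ((u x : ℝ) : AddCircle (1 : ℝ))) fun _ ↦ 0) := by
    refine Continuous.piecewise (fun x hx ↦ ?_)
      ((AddCircle.continuous_mk' (1 : ℝ)).comp u.continuous) continuous_const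
    rcases hfr hx with h | h
    · simp [huA h]
    · simp [huB h]
  have cov := AddCircle.isCoveringMap_coe (1 : ℝ)
  obtain ⟨g, ⟨hgp, hg⟩, -⟩ := cov.existsUnique_continuousMap_lifts ⟨_, hc⟩ p (u p) (by simp [hpW])
  -- Along `R`, the lift must be `u` inside `W` and the constant `c` outside: this too is a
  -- continuous lift, and it agrees with `g` at `p`.
  have key : ∀ (R : Set X) (c : ℝ), IsPreconnected R → p ∈ R → q ∈ R →
      ((c : ℝ) : AddCircle (1 : ℝ)) = 0 → (∀ x ∈ R ∩ frontier W, u x = c) → g q = c := by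
    intro R c hR hpR hqR hc0 hRu
    have hcont : ContinuousOn (W.piecewise u fun _ ↦ c) R :=
      ContinuousOn.piecewise hRu u.continuous.continuousOn continuousOn_const
    have := cov.eqOn_of_comp_eqOn hR g.continuous.continuousOn hcont (fun x _ ↦ by
      rw [hg]
      by_cases hx : x ∈ W <;> simp [hx, hc0]) hpR (by simp [hpW, hgp])
    simpa [hqW] using this hqR
  have h1 := key S 1 hS hpS hqS (by simp) fun x hx ↦
    (hfr hx.2).elim (fun h ↦ (hSA.le_bot ⟨hx.1, h⟩).elim) fun h ↦ huB h
  have h0 := key T 0 hT hpT hqT (by simp) fun x hx ↦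
    (hfr hx.2).elim (fun h ↦ huA h) fun h ↦ (hTB.le_bot ⟨hx.1, h⟩).elim
  linarith

/-- A compact set splits into two disjoint closed parts, the first containing a given point `p`, the
second containing a given finite set of points outside the component of `p`. -/
theorem IsCompact.exists_isClosed_split {X : Type*} [TopologicalSpace X] [T2Space X] {Z E : Set X}
    (hZ : IsCompact Z) {p : X} (hp : p ∈ Z) (hE : E.Finite) (hEZ : E ⊆ Z)
    (hEp : Disjoint E (connectedComponentIn Z p)) :
    ∃ A B, IsClosed A ∧ IsClosed B ∧ Disjoint A B ∧ A ∪ B = Z ∧ p ∈ A ∧ E ⊆ B := by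
  have := isCompact_iff_compactSpace.1 hZ
  obtain ⟨C, hC, hpC, hCE⟩ : ∃ C : Set Z, IsClopen C ∧ ⟨p, hp⟩ ∈ C ∧
      ∀ e (he : e ∈ E), (⟨e, hEZ he⟩ : Z) ∉ C := by
    have h1 : ∀ e : E, ∃ C : Set Z, IsClopen C ∧ ⟨p, hp⟩ ∈ C ∧ (⟨e, hEZ e.2⟩ : Z) ∉ C := by
      intro e
      by_contra! h
      refine hEp.le_bot ⟨e.2, ?_⟩
      rw [connectedComponentIn_eq_image hp]
      refine ⟨⟨e, hEZ e.2⟩, ?_, rfl⟩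
      -- In a compact Hausdorff space components are quasi-components, so a clopen set excludes `e`.
      rw [connectedComponent_eq_iInter_isClopen]
      exact mem_iInter.2 fun s ↦ h s s.2.1 s.2.2
    choose C hC hpC hCe using h1
    have := hE.to_subtype
    exact ⟨⋂ e, C e, isClopen_iInter_of_finite hC, mem_iInter.2 hpC,
      fun e he h ↦ hCe ⟨e, he⟩ (mem_iInter.1 h ⟨e, he⟩)⟩
  refine ⟨(↑) '' C, (↑) '' Cᶜ, (hC.1.isCompact.image continuous_subtype_val).isClosed,
    (hC.compl.1.isCompact.image continuous_subtype_val).isClosed,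
    (disjoint_image_iff Subtype.val_injective).2 disjoint_compl_right, ?_, ⟨_, hpC, rfl⟩,
    fun e he ↦ ⟨⟨e, hEZ he⟩, hCE e he, rfl⟩⟩
  rw [← image_union, union_compl_self, image_univ, Subtype.range_coe]

theorem mem_frontier_rectangle {M : ℝ} (hM : 0 < M) {x y : ℝ} :
    (x, y) ∈ frontier (rectangle M) ↔
      (x, y) ∈ rectangle M ∧ (x = 0 ∨ x = 1 ∨ y = -M ∨ y = M) := by
  rw [rectangle, frontier_prod_eq, frontier_Icc (by linarith), frontier_Icc (by norm_num),
    isClosed_Icc.closure_eq, isClosed_Icc.closure_eq]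
  simp only [mem_union, mem_prod, mem_insert_iff, mem_singleton_iff, mem_Icc]
  constructor
  · rintro (⟨h, rfl | rfl⟩ | ⟨rfl | rfl, h⟩)
    · exact ⟨⟨h, le_rfl, by linarith⟩, by simp⟩
    · exact ⟨⟨h, by linarith, le_rfl⟩, by simp⟩
    · exact ⟨⟨by norm_num, h⟩, by simp⟩
    · exact ⟨⟨by norm_num, h⟩, by simp⟩
  · rintro ⟨⟨h1, h2⟩, h⟩
    tauto

/-- The nearest-point retraction of the plane onto the rectangle. -/
noncomputable def rectangleRetraction (M : ℝ) (p : ℝ × ℝ) : ℝ × ℝ :=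
  (max 0 (min 1 p.1), max (-M) (min M p.2))

theorem continuous_rectangleRetraction (M : ℝ) : Continuous (rectangleRetraction M) := by
  unfold rectangleRetraction
  fun_prop

theorem rectangleRetraction_mem {M : ℝ} (hM : 0 < M) (p : ℝ × ℝ) :
    rectangleRetraction M p ∈ rectangle M :=
  ⟨⟨le_max_left _ _, max_le zero_le_one (min_le_left _ _)⟩,
    ⟨le_max_left _ _, max_le (by linarith) (min_le_left _ _)⟩⟩

theorem rectangleRetraction_of_mem {M : ℝ} {p : ℝ × ℝ} (hp : p ∈ rectangle M) :
    rectangleRetraction M p = p := by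
  obtain ⟨⟨h1, h2⟩, h3, h4⟩ := hp
  simp [rectangleRetraction, h1, h2, h3, h4]

/-- The boundary of the rectangle minus a segment of its right edge is connected. -/
theorem isPreconnected_frontier_rectangle_diff {M : ℝ} (hM : 0 < M) {a b : ℝ}
    (ha : a ∈ Ioo (-M) M) (hb : b ∈ Ioo (-M) M) (hab : a < b) :
    IsPreconnected (frontier (rectangle M) \ {1} ×ˢ Ioo a b) := by
  have h : frontier (rectangle M) \ {1} ×ˢ Ioo a b =
      (({1} ×ˢ Icc (-M) a ∪ Icc 0 1 ×ˢ {-M}) ∪ {0} ×ˢ Icc (-M) M) ∪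
        (Icc 0 1 ×ˢ {M} ∪ {1} ×ˢ Icc b M) := by
    obtain ⟨ha1, ha2⟩ := ha
    obtain ⟨hb1, hb2⟩ := hb
    ext ⟨x, y⟩
    rw [mem_sdiff, mem_frontier_rectangle hM]
    simp only [rectangle, mem_union, mem_prod, mem_singleton_iff, mem_Icc, mem_Ioo]
    grind
  rw [h]
  refine IsPreconnected.union (0, M) (by simp [hM.le]) (by simp) ?_ ?_
  · refine IsPreconnected.union (0, -M) (by simp) (by simp [hM.le]) ?_ ?_
    · exact IsPreconnected.union (1, -M) (by simp [ha.1.le]) (by simp)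
        (isPreconnected_singleton.prod isPreconnected_Icc)
        (isPreconnected_Icc.prod isPreconnected_singleton)
    · exact isPreconnected_singleton.prod isPreconnected_Icc
  · exact IsPreconnected.union (1, M) (by simp) (by simp [hb.2.le])
      (isPreconnected_Icc.prod isPreconnected_singleton)
      (isPreconnected_singleton.prod isPreconnected_Icc)

theorem isCompact_zeroSet {M : ℝ} {G : ℝ × ℝ → ℝ} (hG : ContinuousOn G (rectangle M)) :
    IsCompact (zeroSet M G) := by
  have hR : IsCompact (rectangle M) := isCompact_Icc.prod isCompact_Icc
  exact hR.of_isClosed_subset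
    (hG.preimage_isClosed_of_isClosed hR.isClosed (isClosed_singleton (x := (0 : ℝ))))
    fun _ h ↦ h.1

/-- Around a point of an open interval there are arbitrarily close points on both sides such that
the segment between them meets a given finite set at most in the point itself. -/
theorem exists_Icc_avoiding_finite {l r y ε : ℝ} (hy : y ∈ Ioo l r) (hε : 0 < ε) {E : Set ℝ}
    (hE : E.Finite) :
    ∃ a ∈ Ioo l r, ∃ b ∈ Ioo l r, y - ε < a ∧ a < y ∧ y < b ∧ b < y + ε ∧
      ∀ z ∈ Icc a b, z ∈ E → z = y := by
  have hN : Ioo l r ∩ Ioo (y - ε) (y + ε) ∩ (E \ {y})ᶜ ∈ nhds y :=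
    Filter.inter_mem (Filter.inter_mem (isOpen_Ioo.mem_nhds hy)
      (isOpen_Ioo.mem_nhds ⟨by linarith, by linarith⟩))
      ((hE.subset sdiff_subset).isClosed.isOpen_compl.mem_nhds fun h ↦ h.2 rfl)
  obtain ⟨δ, hδ, hsub⟩ := Metric.nhds_basis_closedBall.mem_iff.1 hN
  rw [Real.closedBall_eq_Icc] at hsub
  have ha := hsub (⟨le_rfl, by linarith⟩ : y - δ ∈ Icc (y - δ) (y + δ))
  have hb := hsub (⟨by linarith, le_rfl⟩ : y + δ ∈ Icc (y - δ) (y + δ))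
  refine ⟨y - δ, ha.1.1, y + δ, hb.1.1, ha.1.2.1, by linarith, by linarith, hb.1.2.2,
    fun z hz hzE ↦ ?_⟩
  by_contra hzy
  exact (hsub hz).2 ⟨hzE, hzy⟩

theorem mainTheorem2 (M : ℝ) (hM : 0 < M) (G : ℝ × ℝ → ℝ)
    (hG : ContinuousOn G (rectangle M))
    (hfin : (zeroSet M G ∩ frontier (rectangle M)).Finite)
    (hedge : zeroSet M G ∩ frontier (rectangle M) ⊆ rightEdge M)
    (F : Set (ℝ × ℝ)) (hF : IsComponentOf F (zeroSet M G))
    (y₀ : ℝ) (hy₀ : F ∩ rightEdge M = {((1 : ℝ), y₀)}) :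
    ∀ ε > 0, ∃ y₁ ∈ Ioo (-M) M, ∃ y₂ ∈ Ioo (-M) M,
      y₀ - ε < y₁ ∧ y₁ < y₀ ∧ y₀ < y₂ ∧ y₂ < y₀ + ε ∧
      JoinedIn (rectangle M \ zeroSet M G) ((1 : ℝ), y₁) ((1 : ℝ), y₂) := by
  intro ε hε
  obtain ⟨p, hpZ, rfl⟩ := hF
  set Z := zeroSet M G
  obtain ⟨hF₀, -, hy₀M⟩ : ((1 : ℝ), y₀) ∈ connectedComponentIn Z p ∩ rightEdge M :=
    hy₀ ▸ mem_singleton _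
  rw [connectedComponentIn_eq hF₀] at hy₀
  have hP₀Z : ((1 : ℝ), y₀) ∈ Z := connectedComponentIn_subset _ _ hF₀
  obtain ⟨A, B, hA, hB, hAB, hABZ, hP₀A, hEB⟩ :=
    (isCompact_zeroSet hG).exists_isClosed_split hP₀Z
      (hfin.subset (sdiff_subset (t := {((1 : ℝ), y₀)}))) (fun x hx ↦ hx.1.1)
      (disjoint_left.2 fun x hx hxF ↦ hx.2 (hy₀ ▸ ⟨hxF, hedge hx.1⟩))
  obtain ⟨a, ha, b, hb, hεa, hay, hyb, hbε, hE⟩ :=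
    exists_Icc_avoiding_finite hy₀M hε (hfin.image Prod.snd)
  refine ⟨a, ha, b, hb, hεa, hay, hyb, hbε, ?_⟩
  have hsegR : ∀ y ∈ Icc a b, ((1 : ℝ), y) ∈ frontier (rectangle M) := fun y hy ↦
    (mem_frontier_rectangle hM).2
      ⟨⟨by norm_num, by linarith [ha.1, hy.1], by linarith [hb.2, hy.2]⟩, by simp⟩
  have hfrR : frontier (rectangle M) ⊆ rectangle M := fun x hx ↦
    ((mem_frontier_rectangle hM).1 hx).1
  have hr := continuous_rectangleRetraction M
  have haR : ((1 : ℝ), a) ∈ frontier (rectangle M) := hsegR a ⟨le_rfl, by linarith⟩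
  have hbR : ((1 : ℝ), b) ∈ frontier (rectangle M) := hsegR b ⟨by linarith, le_rfl⟩
  -- Pulling back along the retraction moves the problem to the simply connected plane; the
  -- resulting path is then retracted into the rectangle.
  have key : JoinedIn (rectangleRetraction M ⁻¹' A ∪ rectangleRetraction M ⁻¹' B)ᶜ
      ((1 : ℝ), a) ((1 : ℝ), b) := by
    refine joinedIn_compl_union_of_disjoint (hA.preimage hr) (hB.preimage hr) (hAB.preimage _)
      (isPreconnected_frontier_rectangle_diff hM ha hb (hay.trans hyb)) ?_ ⟨haR, by simp⟩
      ⟨hbR, by simp⟩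
      ((isPreconnected_singleton (x := (1 : ℝ))).prod (isPreconnected_Icc (a := a) (b := b))) ?_
      (by simp [(hay.trans hyb).le]) (by simp [(hay.trans hyb).le])
    · refine disjoint_left.2 fun x hx hxA ↦ ?_
      rw [mem_preimage, rectangleRetraction_of_mem (hfrR hx.1)] at hxA
      by_cases hx0 : x = (1, y₀)
      · exact hx.2 (hx0 ▸ ⟨rfl, hay, hyb⟩)
      · exact hAB.le_bot ⟨hxA, hEB ⟨⟨hABZ.subset <| Or.inl hxA, hx.1⟩, hx0⟩⟩
    · refine disjoint_left.2 ?_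
      rintro ⟨x, y⟩ ⟨hx, hy⟩ hxB
      obtain rfl : x = 1 := hx
      have hxR := hsegR y hy
      rw [mem_preimage, rectangleRetraction_of_mem (hfrR hxR)] at hxB
      obtain rfl := hE y hy ⟨(1, y), ⟨hABZ.subset <| Or.inr hxB, hxR⟩, rfl⟩
      exact hAB.le_bot ⟨hP₀A, hxB⟩
  have := key.map hr
  rw [rectangleRetraction_of_mem (hfrR haR), rectangleRetraction_of_mem (hfrR hbR)] at this
  refine this.mono ?_
  rintro _ ⟨x, hx, rfl⟩
  refine ⟨rectangleRetraction_mem hM x, fun h ↦ hx ?_⟩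
  rwa [← preimage_union, hABZ]
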